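/- Let $G$ be a finite abelian group (written additively) and let $\widehat G$ be the group of characters $G\to U(1)$. Let $\mathcal L$ be a lattice, with oriented edges, on a closed oriented surface $\Sigma$: its vertices $V$, edges $E$ and faces $P$ form a finite cell decomposition of $\Sigma$ into points, open arcs and open disks, every edge is bounded by exactly two vertices, and every edge lies on the boundary of exactly two faces. Let $\mathcal L^*$ be the dual lattice. Put $\mathcal H_{\mathrm{tot}}=\bigotimes_{e\in E}\mathbb C[G]$, $X_g|h\rangle=|g+h\rangle$ and $Z_\gamma|h\rangle=\gamma(h)|h\rangle$. Let $\varepsilon(e,v)=1$ if $e$ points away from $v$, $-1$ if $e$ points to $v$, and $0$ if $e$ is not incident to $v$; let $\varepsilon(e,p)=1$ if $e$ runs counterclockwise along $\partial p$, $-1$ if it runs clockwise, and $0$ if $e\not\subset\partial p$. Put $A_g(v)=\bigotimes_{e\in E}X_{\varepsilon(e,v)g}$, and let $B_h(p)$ be the projection that fixes $\bigotimes_e|x_e\rangle$ if $\sum_e\varepsilon(e,p)x_e=h$ and sends it to $0$ otherwise. Let $A(v)=\frac1{|G|}\sum_{g\in G}A_g(v)$, $B(p)=B_0(p)$, and let $$V_{gs}=\{\psi\in\mathcal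 H_{\mathrm{tot}} : A(v)\psi=\psi \text{ and } B(p)\psi=\psi \text{ for all } v\in V,\ p\in P\}$$ be the space of ground states. Let $R=\bigotimes_{e\in E}X_{g_e}Z_{\gamma_e}$ with $g_e\in G$ and $\gamma_e\in\widehat G$, and put $R_X=\bigotimes_eX_{g_e}$ and $R_Z=\bigotimes_eZ_{\gamma_e}$. For a vertex $v$ on the boundary of a face $p$, let $$P_{(g,\gamma)}(v,p)=\frac1{|G|}\,B_g(p)\sum_{h\in G}\overline{\gamma(h)}\,A_h(v).$$ For a nonzero $\psi\in V_{gs}$ there is exactly one $(g,\gamma)$ with $P_{(g,\gamma)}(v,p)R\psi=R\psi$; here $\gamma=:\mathrm{Syn}_R(v)$ depends only on $R$ and $v$, and $g=:\mathrm{Syn}_R(p)$ depends only on $R$ and $p$. Let $\mathcal G(R_Z)\subset\mathcal L$ be the subgraph formed by the edges $e$ with $Z_{\gamma_e}\ne\mathrm{Id}$, and let $\mathcal G^*(R_X)\subset\mathcal L^*$ be the subgraph formed by the duals of the edges $e$ with $X_{g_e}\neq\mathrm{Id}$. A subgraph of $\mathcal L$ or $\mathcal L^*$ is called contractible if every (simple)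 cycle in it bounds a disk in $\Sigma$. **Theorem.** 1. If $\mathrm{Syn}_R(v)=\mathbf 1$ for all $v\in V$ and $\mathcal G(R_Z)$ is contractible, then $R_Z\psi=\psi$ for all $\psi\in V_{gs}$. 2. If $\mathrm{Syn}_R(p)=0$ for all $p\in P$ and $\mathcal G^*(R_X)$ is contractible in the dual lattice, then $R_X\psi=\psi$ for all $\psi\in V_{gs}$. -/

import Mathlib

noncomputable section

namespace Kitaev

open scoped TensorProduct

/-! ## Oriented lattices on closed oriented surfaces -/

/-- The reversal of darts. A dart is an edge with a direction of travel: `(e, true)` travels along the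
orientation of `e` and `(e, false)` against it. -/
def rev {E : Type*} : Equiv.Perm (E × Bool) where
  toFun d := (d.1, !d.2)
  invFun d := (d.1, !d.2)
  left_inv d := by simp
  right_inv d := by simp

/-- An oriented lattice on a closed oriented surface, with vertices `V`, oriented edges `E` and
faces `P` (open disks), as a combinatorial map (rotation system). The vertex `origin d` is where the
dart `d` starts; the face `face d` is the one on the left of `d`, that is, the face along whose
boundary `d` runs counterclockwise; `next d` is the dart that follows `d` when one travels
counterclockwise around `face d`. Thus faces are the cycles of `next`. The map `d ↦ next (rev d)`
takes a dart to its clockwise neighbour among the darts with the same origin, so that vertices are the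
cycles of this map. Every edge is bounded by exactly two vertices, and lies on the boundary of exactly
two faces. The surface is compact when `E` is finite; it is not required to be connected. -/
structure OrientedLattice (V E P : Type*) where
  origin : E × Bool → V
  face : E × Bool → P
  next : Equiv.Perm (E × Bool)
  origin_surjective : Function.Surjective origin
  face_surjective : Function.Surjective face
  face_eq_iff : ∀ d d', face d = face d' ↔ next.SameCycle d d'
  origin_eq_iff : ∀ d d', origin d = origin d' ↔ (next * rev).SameCycle d d'
  origin_ne : ∀ e, origin (e, true) ≠ origin (e, false)
  face_ne : ∀ e, face (e, true) ≠ face (e, false)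

/-- `X_g |h⟩ = |g + h⟩` on `ℂ[G]`. -/
def X {G : Type*} [AddCommGroup G] (g : G) : (G →₀ ℂ) →ₗ[ℂ] (G →₀ ℂ) :=
  Finsupp.linearCombination ℂ fun h => Finsupp.single (g + h) 1

/-- `Z_γ |h⟩ = γ(h) |h⟩` on `ℂ[G]`, for a character `γ : G → U(1)`. -/
def Z {G : Type*} [AddCommGroup G] (γ : AddChar G Circle) : (G →₀ ℂ) →ₗ[ℂ] (G →₀ ℂ) :=
  Finsupp.linearCombination ℂ fun h => Finsupp.single h (γ h : ℂ)

/-- The total space `⨂_{e ∈ E} ℂ[G]`. -/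
abbrev TotalSpace (E G : Type*) : Type _ := ⨂[ℂ] _ : E, (G →₀ ℂ)

/-- The basis vectors `⨂_{e} |x_e⟩` of the total space, indexed by `x : E → G`. -/
def ketBasis (E G : Type*) [Fintype E] : Module.Basis (E → G) ℂ (TotalSpace E G) :=
  Basis.piTensorProduct fun _ : E => (Finsupp.basisSingleOne : Module.Basis G ℂ (G →₀ ℂ))

/-- A basic error `R = ⨂_e X_{g_e} Z_{γ_e}`, given by the families `g` and `γ`. -/
structure PauliError (E G : Type*) [AddCommGroup G] where
  g : E → G
  γ : E → AddChar G Circle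

namespace PauliError

variable {E G : Type*} [AddCommGroup G]

/-- The operator `⨂_e X_{g_e} Z_{γ_e}` on the total space. -/
def op (R : PauliError E G) : TotalSpace E G →ₗ[ℂ] TotalSpace E G :=
  PiTensorProduct.map fun e => X (R.g e) ∘ₗ Z (R.γ e)

/-- `R_X = ⨂_e X_{g_e}`. -/
def xPart (R : PauliError E G) : PauliError E G := ⟨R.g, fun _ => 1⟩

/-- `R_Z = ⨂_e Z_{γ_e}`. -/
def zPart (R : PauliError E G) : PauliError E G := ⟨fun _ => 0, R.γ⟩

/-- The graph `𝒢(R)`: the edges on which `R` does not act as the identity. The same set of edges, seen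
in the dual lattice, is `𝒢*(R)`. -/
def graph (R : PauliError E G) : Set E :=
  {e | X (R.g e) ∘ₗ Z (R.γ e) ≠ LinearMap.id}

end PauliError

namespace OrientedLattice

variable {V E P : Type*}

/-- The dual lattice: vertices and faces are exchanged, and `e*` crosses `e` from the face on its
right to the face on its left (`e` rotated counterclockwise). The face of the dual lattice on the left
of a dart is the origin of that dart in the primal lattice, and one travels counterclockwise around
it by passing to the counterclockwise neighbour, the inverse of `d ↦ next (rev d)`. -/
def dual (L : OrientedLattice V E P) : OrientedLattice P E V where
  origin d := L.face (rev d)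
  face := L.origin
  next := (L.next * rev)⁻¹
  origin_surjective := L.face_surjective.comp rev.surjective
  face_surjective := L.origin_surjective
  face_eq_iff d d' := by rw [Equiv.Perm.sameCycle_inv, L.origin_eq_iff]
  origin_eq_iff d d' := by
    have h : (L.next * rev)⁻¹ * rev = rev⁻¹ * L.next⁻¹ * (rev⁻¹)⁻¹ := by
      rw [mul_inv_rev, inv_inv]
    rw [h, Equiv.Perm.sameCycle_conj, inv_inv, Equiv.Perm.sameCycle_inv, L.face_eq_iff]
  origin_ne e := (L.face_ne e).symm
  face_ne := L.origin_ne

/-! ## Cycles and contractible subgraphs -/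

/-- A cycle: distinct edges `e₀, …, eₙ` and distinct vertices `v₀, …, vₙ` such that `eᵢ` joins `vᵢ` and
`vᵢ₊₁`, with indices modulo `n + 1`. (As edges join distinct vertices, there are at least two.) -/
structure Cycle (L : OrientedLattice V E P) where
  n : ℕ
  edge : Fin (n + 1) → E
  vert : Fin (n + 1) → V
  edge_injective : Function.Injective edge
  vert_injective : Function.Injective vert
  joins : ∀ i, s(L.origin (edge i, true), L.origin (edge i, false)) = s(vert i, vert (i + 1))

/-- The edges on the boundary of some face in `S`. -/
def edgesOf (L : OrientedLattice V E P) (S : Set P) : Set E := {e | ∃ b, L.face (e, b) ∈ S}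

/-- The vertices on the boundary of some face in `S`. -/
def vertsOf (L : OrientedLattice V E P) (S : Set P) : Set V :=
  {v | ∃ d, L.origin d = v ∧ L.face d ∈ S}

/-- Two faces share an edge. -/
def FaceAdj (L : OrientedLattice V E P) (p q : P) : Prop :=
  ∃ d, L.face d = p ∧ L.face (rev d) = q

/-- `C` bounds a disk in the surface: there is a set `S` of faces such that the union of the closed
faces in `S` is a disk with boundary `C`. By the classification of surfaces this means that `C` consists
of the edges that have a face in `S` on exactly one of their two sides (so that the union is a
surface whose boundary is the circle `C`), that the union has connected interior (any two faces of `S`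
are joined by a chain of faces of `S` in which consecutive faces share an edge), and that its Euler
characteristic is `1`. -/
def Cycle.BoundsDisk {L : OrientedLattice V E P} (C : L.Cycle) : Prop :=
  ∃ S : Set P,
    (∀ e, e ∈ Set.range C.edge ↔ Xor (L.face (e, true) ∈ S) (L.face (e, false) ∈ S)) ∧
    (∀ p ∈ S, ∀ q ∈ S,
      Relation.ReflTransGen (fun a b => a ∈ S ∧ b ∈ S ∧ L.FaceAdj a b) p q) ∧
    ((L.vertsOf S).ncard : ℤ) - ((L.edgesOf S).ncard : ℤ) + (S.ncard : ℤ) = 1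

/-- The subgraph with edge set `F` is contractible: each of its cycles bounds a disk. -/
def IsContractible (L : OrientedLattice V E P) (F : Set E) : Prop :=
  ∀ C : L.Cycle, Set.range C.edge ⊆ F → C.BoundsDisk

/-! ## The model for a finite abelian group -/

open Classical in
/-- `ε(e, v)`: it is `1` if `e` points away from `v`, `-1` if `e` points to `v`, and (an extension by
zero) `0` if `e` is not in the star of `v`. -/
def vertexSign (L : OrientedLattice V E P) (e : E) (v : V) : ℤ :=
  if L.origin (e, true) = v then 1 else if L.origin (e, false) = v then -1 else 0

open Classical in
/-- `ε(e, p)`: it is `1` if `e` runs counterclockwise along `∂p`, `-1` if it runs clockwise, and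
(an extension by zero) `0` if `e` is not in `∂p`. -/
def faceSign (L : OrientedLattice V E P) (e : E) (p : P) : ℤ :=
  if L.face (e, true) = p then 1 else if L.face (e, false) = p then -1 else 0

/-- A site is a pair of a vertex and a face that is incident to it. -/
def IsSite (L : OrientedLattice V E P) (v : V) (p : P) : Prop :=
  ∃ d, L.origin d = v ∧ L.face d = p

variable {G : Type*} [AddCommGroup G]

/-- `A_g(v)` applies `X_g` to the edges that point away from `v`, `X_{-g}` to those that point to
`v`, and the identity `X_0` to all others. -/
def vertexOp (L : OrientedLattice V E P) (g : G) (v : V) : TotalSpace E G →ₗ[ℂ] TotalSpace E G :=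
  PiTensorProduct.map fun e => X (L.vertexSign e v • g)

variable [Fintype E]

open Classical in
/-- `B_h(p)` is the projection onto the span of the basis vectors `⨂_e |x_e⟩` for which the sum of the
`x_e` around `∂p`, taken counterclockwise and with signs, equals `h`. -/
def faceOp (L : OrientedLattice V E P) (h : G) (p : P) : TotalSpace E G →ₗ[ℂ] TotalSpace E G :=
  (ketBasis E G).constr ℂ fun x =>
    if ∑ e, L.faceSign e p • x e = h then ketBasis E G x else 0

variable [Fintype G]

/-- `A(v) = |G|⁻¹ ∑_g A_g(v)`. -/
def vertexProj (G : Type*) [AddCommGroup G] [Fintype G] (L : OrientedLattice V E P) (v : V) :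
    TotalSpace E G →ₗ[ℂ] TotalSpace E G :=
  (Fintype.card G : ℂ)⁻¹ • ∑ g : G, L.vertexOp g v

/-- The space of ground states: `A(v) ψ = ψ` for all `v` and `B(p) ψ = B_0(p) ψ = ψ` for all `p`. -/
def groundSpace (L : OrientedLattice V E P) (G : Type*) [AddCommGroup G] [Fintype G] :
    Submodule ℂ (TotalSpace E G) where
  carrier := {ψ | (∀ v, L.vertexProj G v ψ = ψ) ∧ ∀ p, L.faceOp (0 : G) p ψ = ψ}
  add_mem' := by
    rintro a b ⟨ha, ha'⟩ ⟨hb, hb'⟩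
    exact ⟨fun v => by rw [map_add, ha, hb], fun p => by rw [map_add, ha', hb']⟩
  zero_mem' := ⟨fun v => map_zero _, fun p => map_zero _⟩
  smul_mem' := by
    rintro c a ⟨ha, ha'⟩
    exact ⟨fun v => by rw [map_smul, ha], fun p => by rw [map_smul, ha']⟩

/-- The projectors `P_{(g, χ)}(v, p) = |G|⁻¹ B_g(p) ∑_h conj(χ(h)) A_h(v)`. -/
def siteProj (L : OrientedLattice V E P) (g : G) (χ : AddChar G Circle) (v : V) (p : P) :
    TotalSpace E G →ₗ[ℂ] TotalSpace E G :=
  (Fintype.card G : ℂ)⁻¹ •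
    (L.faceOp g p ∘ₗ ∑ h : G, (starRingEnd ℂ) (χ h : ℂ) • L.vertexOp h v)

/-- `Syn_R(v) = χ`: for a nonzero ground state `ψ` and a site `(v, p)` at `v`, the state `R ψ` is fixed
by a projector `P_{(g, χ)}(v, p)`. (The character `χ` depends neither on `ψ` nor on `p`.) -/
def HasVertexSyndrome (L : OrientedLattice V E P) (R : PauliError E G) (v : V)
    (χ : AddChar G Circle) : Prop :=
  ∃ ψ ∈ L.groundSpace G, ψ ≠ 0 ∧ ∃ p, L.IsSite v p ∧
    ∃ g, L.siteProj g χ v p (R.op ψ) = R.op ψ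

/-- `Syn_R(p) = g`: for a nonzero ground state `ψ` and a site `(v, p)` at `p`, the state `R ψ` is fixed
by a projector `P_{(g, χ)}(v, p)`. (The element `g` depends neither on `ψ` nor on `v`.) -/
def HasFaceSyndrome (L : OrientedLattice V E P) (R : PauliError E G) (p : P) (g : G) : Prop :=
  ∃ ψ ∈ L.groundSpace G, ψ ≠ 0 ∧ ∃ v, L.IsSite v p ∧
    ∃ χ, L.siteProj g χ v p (R.op ψ) = R.op ψ

end OrientedLattice

end Kitaev

end

noncomputable section

namespace Kitaev

namespace OrientedLattice

/-! ### Chains on the lattice: boundaries, cycles and contractible supports -/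

variable {V E P A : Type*} [AddCommGroup A]

/-! The characters `R.γ` form a 1-chain with coefficients in the dual group, and trivial vertex
syndromes make it a 1-cycle. A nonzero 1-cycle contains a simple cycle in its support; by
contractibility this one encloses a set of faces, and subtracting a multiple of the boundary of that
set kills an edge without enlarging the support. By induction the chain is a boundary
(`IsContractible.exists_boundary_eq`). The phase of `R_Z` on a ket is then a product of characters
of signed face sums, all zero on the kets that occur in a ground state. The second claim uses the
same lemma on the dual lattice: a dual boundary is a coboundary, so `R_X` is a product of vertex
operators, which fix ground states. -/

theorem vertexSign_smul (L : OrientedLattice V E P) [DecidableEq V] (e : E) (v : V) (a : A) :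
    L.vertexSign e v • a =
      (if L.origin (e, true) = v then a else 0) - (if L.origin (e, false) = v then a else 0) := by
  have h := L.origin_ne e
  unfold vertexSign
  split_ifs with h1 h2 h2 <;> simp_all

theorem faceSign_smul (L : OrientedLattice V E P) [DecidableEq P] (e : E) (p : P) (a : A) :
    L.faceSign e p • a =
      (if L.face (e, true) = p then a else 0) - (if L.face (e, false) = p then a else 0) := by
  have h := L.face_ne e
  unfold faceSign
  split_ifs with h1 h2 h2 <;> simp_all

theorem dual_vertexSign (L : OrientedLattice V E P) (e : E) (p : P) :
    L.dual.vertexSign e p = -L.faceSign e p := by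
  classical
  have h := L.face_ne e
  change (if L.face (e, false) = p then (1 : ℤ) else if L.face (e, true) = p then -1 else 0) =
    -(if L.face (e, true) = p then (1 : ℤ) else if L.face (e, false) = p then -1 else 0)
  split_ifs <;> simp_all

theorem origin_next_rev (L : OrientedLattice V E P) (d : E × Bool) :
    L.origin (L.next (rev d)) = L.origin d :=
  (L.origin_eq_iff _ _).2 (Equiv.Perm.SameCycle.rfl.apply_left (f := L.next * rev))

theorem face_next (L : OrientedLattice V E P) (d : E × Bool) :
    L.face (L.next d) = L.face d :=
  (L.face_eq_iff _ _).2 (Equiv.Perm.SameCycle.rfl.apply_left)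

/-- The boundary of a 2-chain is a 1-cycle. -/
theorem sum_vertexSign_smul_boundary [Fintype E] (L : OrientedLattice V E P) (c : P → A) (v : V) :
    ∑ e, L.vertexSign e v • (c (L.face (e, true)) - c (L.face (e, false))) = 0 := by
  classical
  -- Clockwise rotation permutes the darts at `v` and takes the right face of a dart to the left
  -- face of its image.
  have key : ∑ d : E × Bool, (if L.origin d = v then c (L.face d) else 0) =
      ∑ d : E × Bool, (if L.origin d = v then c (L.face (rev d)) else 0) := by
    rw [← Equiv.sum_comp (L.next * rev)]
    simp [Equiv.Perm.mul_apply, origin_next_rev, face_next]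
  rw [Fintype.sum_prod_type, Fintype.sum_prod_type, ← sub_eq_zero, ← Finset.sum_sub_distrib] at key
  rw [← key]
  refine Finset.sum_congr rfl fun e _ => ?_
  rw [vertexSign_smul]
  simp only [Fintype.sum_bool, rev, Equiv.coe_fn_mk, Bool.not_true, Bool.not_false]
  split_ifs <;> abel

/-- A nonempty set of darts in which every dart has a successor on a different edge contains
the edges of a cycle. -/
theorem exists_cycle_of_forall_exists_next [Finite E] (L : OrientedLattice V E P) (F : Set E)
    (d₀ : E × Bool) (h₀ : d₀.1 ∈ F)
    (h : ∀ d : E × Bool, d.1 ∈ F →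
      ∃ d' : E × Bool, d'.1 ∈ F ∧ L.origin d' = L.origin (rev d) ∧ d'.1 ≠ d.1) :
    ∃ C : L.Cycle, Set.range C.edge ⊆ F := by
  classical
  choose! f hfF hfo hfe using h
  set D : ℕ → E × Bool := fun k => f^[k] d₀ with hD
  have hs : ∀ k, D (k + 1) = f (D k) := fun k => Function.iterate_succ_apply' f k d₀
  have hF : ∀ k, (D k).1 ∈ F := by
    intro k
    induction k with
    | zero => exact h₀
    | succ k ih => rw [hs]; exact hfF _ ih
  have ho : ∀ k, L.origin (D (k + 1)) = L.origin (rev (D k)) := fun k => by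
    rw [hs]; exact hfo _ (hF k)
  have he : ∀ k, (D (k + 1)).1 ≠ (D k).1 := fun k => by
    rw [hs]; exact hfe _ (hF k)
  have hj : ∀ k, s(L.origin ((D k).1, true), L.origin ((D k).1, false)) =
      s(L.origin (D k), L.origin (D (k + 1))) := by
    intro k
    rw [ho]
    generalize D k = d
    obtain ⟨e, b⟩ := d
    cases b
    · exact Sym2.eq_swap
    · rfl
  have hne : ∀ k, L.origin (D k) ≠ L.origin (D (k + 1)) := by
    intro k
    rw [ho]
    generalize D k = d
    obtain ⟨e, b⟩ := d
    cases b
    · exact (L.origin_ne e).symm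
    · exact L.origin_ne e
  have : Finite V := Finite.of_surjective _ L.origin_surjective
  -- The shortest return time over all starting points of the walk: any shorter window has distinct
  -- vertices.
  have hex : ∃ m, ∃ i, 0 < m ∧ L.origin (D i) = L.origin (D (i + m)) := by
    obtain ⟨i, j, hij, hv⟩ := Finite.exists_ne_map_eq_of_infinite fun k => L.origin (D k)
    rcases Nat.lt_or_gt_of_ne hij with hl | hl
    · exact ⟨j - i, i, by omega, by rw [Nat.add_sub_cancel' hl.le]; exact hv⟩
    · exact ⟨i - j, j, by omega, by rw [Nat.add_sub_cancel' hl.le]; exact hv.symm⟩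
  obtain ⟨i, hm, hv⟩ := Nat.find_spec hex
  have hmin : ∀ a b, a < b → b < a + Nat.find hex → L.origin (D a) ≠ L.origin (D b) := by
    intro a b hab hb hEq
    refine Nat.find_min hex (m := b - a) (by omega) ⟨a, by omega, ?_⟩
    rw [Nat.add_sub_cancel' hab.le]
    exact hEq
  generalize Nat.find hex = m at hm hv hmin
  obtain ⟨n, rfl⟩ : ∃ n, m = n + 1 := ⟨m - 1, by omega⟩
  have hlt : ∀ a b : Fin (n + 1), a < b → L.origin (D (i + a)) ≠ L.origin (D (i + b)) :=
    fun a b hab => hmin _ _ (by have := Fin.lt_def.1 hab; omega) (by have := b.2; omega)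
  have hlt' : ∀ a b : Fin (n + 1), a < b → (D (i + a)).1 ≠ (D (i + b)).1 := by
    intro a b hab hEq
    have h1 := hj (i + a)
    rw [hEq, hj (i + b), Sym2.eq_iff] at h1
    have hab' := Fin.lt_def.1 hab
    have hb := b.2
    -- A repeated edge traversed in the same direction repeats a vertex. Traversed backwards it is
    -- either an immediate reversal, excluded by `he`, or closes a shorter loop.
    rcases h1 with h1 | h1
    · exact hlt a b hab h1.1.symm
    · by_cases hb1 : (b : ℕ) = a + 1
      · rw [hb1, ← add_assoc] at hEq
        exact he _ hEq.symm
      · exact hmin (i + a + 1) (i + b) (by omega) (by omega) h1.1.symm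
  refine ⟨⟨n, fun k => (D (i + k)).1, fun k => L.origin (D (i + k)), ?_, ?_, ?_⟩, ?_⟩
  · intro a b hab
    rcases lt_trichotomy a b with hl | hl | hl
    · exact absurd hab (hlt' _ _ hl)
    · exact hl
    · exact absurd hab.symm (hlt' _ _ hl)
  · intro a b hab
    rcases lt_trichotomy a b with hl | hl | hl
    · exact absurd hab (hlt _ _ hl)
    · exact hl
    · exact absurd hab.symm (hlt _ _ hl)
  · intro k
    rw [hj]
    rcases Fin.eq_castSucc_or_eq_last k with ⟨k', rfl⟩ | rfl
    · simp [Fin.val_succ, add_assoc]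
    · simp [add_assoc, ← hv]
  · rintro _ ⟨k, rfl⟩
    exact hF _

/-- A nonzero 1-cycle contains a simple cycle in its support. -/
theorem exists_cycle_of_sum_eq_zero [Fintype E] (L : OrientedLattice V E P) (a : E → A)
    (ha : ∀ v, ∑ e, L.vertexSign e v • a e = 0) (e₀ : E) (h₀ : a e₀ ≠ 0) :
    ∃ C : L.Cycle, Set.range C.edge ⊆ {e | a e ≠ 0} := by
  classical
  refine L.exists_cycle_of_forall_exists_next _ (e₀, true) h₀ fun d hd => ?_
  -- At a dead end only `e` contributes to the vertex sum, which is then `± a e`.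
  by_contra! hcon
  obtain ⟨e, b⟩ := d
  have hz : ∀ e' ≠ e, L.vertexSign e' (L.origin (rev (e, b))) • a e' = 0 := by
    intro e' he'
    by_cases hae : a e' = 0
    · rw [hae, smul_zero]
    · rw [vertexSign_smul, if_neg fun h => he' (hcon (e', true) hae h),
        if_neg fun h => he' (hcon (e', false) hae h), sub_zero]
  have h1 := ha (L.origin (rev (e, b)))
  rw [Fintype.sum_eq_single e hz, vertexSign_smul] at h1
  have hne := L.origin_ne e
  cases b
  · simp [rev, hne.symm] at h1
    exact hd h1
  · simp [rev, hne] at h1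
    exact hd h1

/-- A 1-cycle whose support is a contractible subgraph is a boundary. -/
theorem IsContractible.exists_boundary_eq [Fintype E] {L : OrientedLattice V E P} (a : E → A)
    (ha : ∀ v, ∑ e, L.vertexSign e v • a e = 0) (hc : L.IsContractible {e | a e ≠ 0}) :
    ∃ c : P → A, ∀ e, a e = c (L.face (e, true)) - c (L.face (e, false)) := by
  classical
  induction hn : {e | a e ≠ 0}.ncard using Nat.strong_induction_on generalizing a with
  | _ n ih =>
  by_cases h0 : ∀ e, a e = 0
  · exact ⟨0, by simpa using h0⟩
  push Not at h0
  obtain ⟨e₀, he₀⟩ := h0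
  obtain ⟨C, hC⟩ := L.exists_cycle_of_sum_eq_zero a ha e₀ he₀
  obtain ⟨S, hS, -, -⟩ := hc C hC
  set e₁ := C.edge 0
  have he₁ : e₁ ∈ Set.range C.edge := ⟨0, rfl⟩
  -- The sign of `x` depends on which side of `e₁` lies in `S`.
  obtain ⟨x, hx⟩ : ∃ x : A, a e₁ = (if L.face (e₁, true) ∈ S then x else 0) -
      (if L.face (e₁, false) ∈ S then x else 0) := by
    rcases (hS e₁).1 he₁ with ⟨h1, h2⟩ | ⟨h1, h2⟩
    · exact ⟨a e₁, by simp [h1, h2]⟩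
    · exact ⟨-a e₁, by simp [h1, h2]⟩
  set c₁ : P → A := fun p => if p ∈ S then x else 0
  -- Off the cycle, both sides or neither lie in `S`, so the correction vanishes there; at `e₁` it
  -- cancels `a` exactly.
  have hsub : {e | a e - (c₁ (L.face (e, true)) - c₁ (L.face (e, false))) ≠ 0} ⊂
      {e | a e ≠ 0} := by
    refine (Set.ssubset_iff_of_subset fun e => mt fun hae => ?_).2
      ⟨e₁, hC he₁, fun h => h (sub_eq_zero.2 hx)⟩
    have : e ∉ Set.range C.edge := fun h => hC h hae
    rw [hS] at this
    rw [hae]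
    by_cases h1 : L.face (e, true) ∈ S <;> by_cases h2 : L.face (e, false) ∈ S <;>
      simp_all [c₁, Xor]
  obtain ⟨c₂, hc₂⟩ := ih _ (hn ▸ Set.ncard_lt_ncard hsub (Set.toFinite _))
    (fun e => a e - (c₁ (L.face (e, true)) - c₁ (L.face (e, false))))
    (fun v => by
      simp only [smul_sub _ (a _), Finset.sum_sub_distrib, ha v,
        L.sum_vertexSign_smul_boundary c₁ v, sub_zero])
    (fun D hD => hc D (hD.trans hsub.subset)) rfl
  refine ⟨c₁ + c₂, fun e => ?_⟩
  have := hc₂ e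
  simp only [Pi.add_apply]
  rw [sub_eq_iff_eq_add] at this
  rw [this]
  abel

end OrientedLattice

/-! ## Operators in the basis of kets -/

theorem ketBasis_apply {E G : Type*} [Fintype E] (x : E → G) :
    ketBasis E G x = PiTensorProduct.tprod ℂ fun e => Finsupp.single (x e) 1 := by
  simp [ketBasis, Basis.piTensorProduct_apply]

variable {V E P G : Type*} [AddCommGroup G]

theorem X_single (g h : G) (c : ℂ) : X g (Finsupp.single h c) = Finsupp.single (g + h) c := by
  simp [X]

theorem Z_single (γ : AddChar G Circle) (h : G) (c : ℂ) :
    Z γ (Finsupp.single h c) = (γ h : ℂ) • Finsupp.single h c := by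
  simp [Z, mul_comm]

namespace PauliError

theorem op_ketBasis [Fintype E] (R : PauliError E G) (x : E → G) :
    R.op (ketBasis E G x) = ((∏ e, R.γ e (x e) : Circle) : ℂ) • ketBasis E G (R.g + x) := by
  simp only [op, ketBasis_apply, PiTensorProduct.map_tprod, LinearMap.comp_apply, Z_single,
    map_smul, X_single, Pi.add_apply]
  rw [MultilinearMap.map_smul_univ]
  congr 1
  exact (map_prod Circle.coeHom _ _).symm

/-- The error with negated labels inverts `R` up to a phase. -/
theorem op_injective [Fintype E] (R : PauliError E G) : Function.Injective R.op := by
  let S : PauliError E G := ⟨-R.g, -R.γ⟩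
  have h : (((∏ e, R.γ e (R.g e) : Circle) : ℂ)) • (S.op ∘ₗ R.op) = LinearMap.id := by
    refine (ketBasis E G).ext fun x => ?_
    simp only [LinearMap.smul_apply, LinearMap.comp_apply, op_ketBasis, map_smul, smul_smul, S,
      neg_add_cancel_left, LinearMap.id_apply]
    rw [← Circle.coe_mul, ← Circle.coe_mul, ← Finset.prod_mul_distrib, ← Finset.prod_mul_distrib,
      Finset.prod_eq_one, Circle.coe_one, one_smul]
    intro e _
    simp [AddChar.map_add_eq_mul, AddChar.map_neg_eq_inv, mul_comm]
  intro ψ φ hψ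
  have := congrArg (fun T => T ψ) h
  have h2 := congrArg (fun T => T φ) h
  simp only [LinearMap.smul_apply, LinearMap.comp_apply, LinearMap.id_apply] at this h2
  rw [← this, ← h2, hψ]

/-- Lets contractibility of the graph pass to the support of the chain `R.γ`. -/
theorem mem_graph_zPart (R : PauliError E G) (e : E) (h : R.γ e ≠ 0) : e ∈ R.zPart.graph := by
  contrapose! h
  simp only [graph, zPart, Set.mem_ofPred_eq, not_not] at h
  ext x
  have := congrArg (fun T => T (Finsupp.single x 1) x) h
  simpa [Z_single, X_single] using this

theorem mem_graph_xPart (R : PauliError E G) (e : E) (h : R.g e ≠ 0) : e ∈ R.xPart.graph := by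
  contrapose! h
  simp only [graph, xPart, Set.mem_ofPred_eq, not_not] at h
  have := congrArg (fun T => T (Finsupp.single 0 1)) h
  simp only [LinearMap.comp_apply, Z_single, map_smul, X_single] at this
  simpa [Finsupp.single_left_inj] using this

end PauliError

/-- The translation operator `⨂_e X_{y_e}`. -/
def shift (y : E → G) : TotalSpace E G →ₗ[ℂ] TotalSpace E G :=
  PiTensorProduct.map fun e => X (y e)

theorem shift_ketBasis [Fintype E] (y x : E → G) :
    shift y (ketBasis E G x) = ketBasis E G (y + x) := by
  simp [shift, ketBasis_apply, PiTensorProduct.map_tprod, X_single]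

theorem shift_add [Fintype E] (y z : E → G) : shift (y + z) = shift y ∘ₗ shift z :=
  (ketBasis E G).ext fun x => by simp [shift_ketBasis, add_assoc]

theorem shift_zero [Fintype E] : shift (0 : E → G) = LinearMap.id :=
  (ketBasis E G).ext fun x => by simp [shift_ketBasis]

theorem PauliError.xPart_op [Fintype E] (R : PauliError E G) : R.xPart.op = shift R.g :=
  (ketBasis E G).ext fun x => by simp [shift_ketBasis, op_ketBasis, xPart]

/-- A Pauli operator commutes with a translation up to a phase. -/
theorem PauliError.op_shift [Fintype E] (R : PauliError E G) (y : E → G) :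
    R.op ∘ₗ shift y = ((∏ e, R.γ e (y e) : Circle) : ℂ) • shift y ∘ₗ R.op :=
  (ketBasis E G).ext fun x => by
    simp [shift_ketBasis, op_ketBasis, AddChar.map_add_eq_mul, Finset.prod_mul_distrib, smul_smul,
      add_left_comm]

/-! ### Stabilizers, syndromes and ground states -/

namespace OrientedLattice

theorem vertexOp_eq_shift (L : OrientedLattice V E P) (g : G) (v : V) :
    L.vertexOp g v = shift fun e => L.vertexSign e v • g := rfl

variable [Fintype E]

open Classical in
theorem faceOp_ketBasis (L : OrientedLattice V E P) (h : G) (p : P) (x : E → G) :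
    L.faceOp h p (ketBasis E G x) =
      if ∑ e, L.faceSign e p • x e = h then ketBasis E G x else 0 := by
  simp [faceOp]

theorem faceOp_comp_faceOp (L : OrientedLattice V E P) (g h : G) (p : P) [Decidable (g = h)] :
    L.faceOp g p ∘ₗ L.faceOp h p = if g = h then L.faceOp g p else 0 :=
  (ketBasis E G).ext fun x => by
    rw [LinearMap.comp_apply, faceOp_ketBasis]
    by_cases h1 : ∑ e, L.faceSign e p • x e = h
    · by_cases h2 : g = h
      · simp [h1, h2, faceOp_ketBasis]
      · simp [h1, h2, faceOp_ketBasis, Ne.symm h2]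
    · by_cases h2 : g = h <;> simp [h1, h2, faceOp_ketBasis]

/-- The `Z` factors are diagonal in the kets, while the `X` factors translate the signed sum around
`p`. -/
theorem faceOp_comp_op (L : OrientedLattice V E P) (R : PauliError E G) (h : G) (p : P) :
    L.faceOp (∑ e, L.faceSign e p • R.g e + h) p ∘ₗ R.op = R.op ∘ₗ L.faceOp h p :=
  (ketBasis E G).ext fun x => by
    have hiff : ∑ e, L.faceSign e p • (R.g + x) e = ∑ e, L.faceSign e p • R.g e + h ↔
        ∑ e, L.faceSign e p • x e = h := by
      simp [smul_add, Finset.sum_add_distrib]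
    rw [LinearMap.comp_apply, LinearMap.comp_apply, PauliError.op_ketBasis, map_smul,
      faceOp_ketBasis, faceOp_ketBasis]
    by_cases hx : ∑ e, L.faceSign e p • x e = h
    · rw [if_pos (hiff.2 hx), if_pos hx, PauliError.op_ketBasis]
    · rw [if_neg (mt hiff.1 hx), if_neg hx, smul_zero, map_zero]

variable [Fintype G]

/-- Translating the summation index absorbs `A_g(v)` into the average over the group. -/
theorem vertexOp_eq_self {L : OrientedLattice V E P} {ψ : TotalSpace E G}
    (hψ : ψ ∈ L.groundSpace G) (g : G) (v : V) : L.vertexOp g v ψ = ψ := by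
  rw [← hψ.1 v]
  simp only [vertexProj, LinearMap.smul_apply, LinearMap.sum_apply, map_smul, map_sum]
  congr 1
  rw [← Equiv.sum_comp (Equiv.addLeft g) fun h => L.vertexOp h v ψ]
  refine Finset.sum_congr rfl fun h _ => ?_
  rw [← LinearMap.comp_apply, vertexOp_eq_shift, vertexOp_eq_shift, ← shift_add, vertexOp_eq_shift]
  congr 1
  simp only [Equiv.coe_addLeft, smul_add]
  rfl

/-- A trivial vertex syndrome means that the characters form a 1-cycle at the vertex. -/
theorem HasVertexSyndrome.sum_eq_zero {L : OrientedLattice V E P} {R : PauliError E G} {v : V}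
    (h : L.HasVertexSyndrome R v 1) : ∑ e, L.vertexSign e v • R.γ e = 0 := by
  obtain ⟨ψ, hψ, hne, p, -, g, hfix⟩ := h
  set χ : AddChar G Circle := ∑ e, L.vertexSign e v • R.γ e
  have hχ : ∀ k, ∏ e, R.γ e (L.vertexSign e v • k) = χ k := fun k => by
    simp [χ, AddChar.sum_apply, AddChar.map_zsmul_eq_zpow]
  have hop : ∀ k, L.vertexOp k v (R.op ψ) = ((-χ) k : ℂ) • R.op ψ := fun k => by
    have h1 := LinearMap.congr_fun (R.op_shift fun e => L.vertexSign e v • k) ψ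
    simp only [hχ, LinearMap.comp_apply, LinearMap.smul_apply, ← vertexOp_eq_shift,
      vertexOp_eq_self hψ] at h1
    conv_rhs => rw [h1]
    rw [smul_smul, ← Circle.coe_mul, AddChar.neg_apply', inv_mul_cancel, Circle.coe_one, one_smul]
  by_contra hχ0
  apply hne
  apply R.op_injective
  rw [map_zero, ← hfix]
  -- By `hop`, the projector for the trivial character acts on `R ψ` through this sum, which
  -- vanishes for a nontrivial `χ`.
  have hsum : ∑ k, ((-χ) k : ℂ) = 0 := by
    have h2 : Circle.coeHom.compAddChar (-χ) ≠ 0 := by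
      intro h3
      apply hχ0
      rw [← neg_eq_zero]
      ext k
      exact DFunLike.congr_fun h3 k
    exact AddChar.sum_eq_zero_iff_ne_zero.2 h2
  simp only [siteProj, LinearMap.smul_apply, LinearMap.comp_apply, LinearMap.sum_apply, hop,
    AddChar.one_apply, Circle.coe_one, map_one, one_smul, ← Finset.sum_smul, hsum, zero_smul,
    map_zero, smul_zero]

/-- A trivial face syndrome means that the group elements satisfy the cocycle condition there. -/
theorem HasFaceSyndrome.sum_eq_zero {L : OrientedLattice V E P} {R : PauliError E G} {p : P}
    (h : L.HasFaceSyndrome R p 0) : ∑ e, L.faceSign e p • R.g e = 0 := by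
  classical
  obtain ⟨ψ, hψ, hne, v, -, χ, hfix⟩ := h
  by_contra hs
  apply hne
  apply R.op_injective
  -- `R ψ` lies in the range of `B_s(p)`, with `s` the signed sum of `R.g`, and also in that of
  -- `B_0(p)`; these are orthogonal when `s ≠ 0`.
  have h1 := LinearMap.congr_fun (L.faceOp_comp_op R 0 p) ψ
  rw [LinearMap.comp_apply, LinearMap.comp_apply, hψ.2 p, add_zero, ← hfix] at h1
  rw [map_zero, ← hfix, ← h1, siteProj, LinearMap.smul_apply, LinearMap.comp_apply, map_smul,
    ← LinearMap.comp_apply, faceOp_comp_faceOp, if_neg hs, LinearMap.zero_apply, smul_zero]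

/-- On the ground space, a Pauli operator of `Z`-type whose characters form a boundary is trivial. -/
theorem zPart_op_eq_self {L : OrientedLattice V E P} {R : PauliError E G} (c : P → AddChar G Circle)
    (hc : ∀ e, R.γ e = c (L.face (e, true)) - c (L.face (e, false))) {ψ : TotalSpace E G}
    (hψ : ψ ∈ L.groundSpace G) : R.zPart.op ψ = ψ := by
  classical
  have : Finite P := Finite.of_surjective _ L.face_surjective
  cases nonempty_fintype P
  -- `B_0(p)` erases the coefficient of every ket with nonzero sum around `p`.
  have hflat : ∀ x, (ketBasis E G).repr ψ x ≠ 0 → ∀ p, ∑ e, L.faceSign e p • x e = 0 := by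
    intro x hx p
    by_contra hp
    apply hx
    have h1 : (ketBasis E G).coord x ∘ₗ L.faceOp 0 p = 0 := (ketBasis E G).ext fun y => by
      rw [LinearMap.comp_apply, faceOp_ketBasis]
      split_ifs with hy
      · have : y ≠ x := by rintro rfl; exact hp hy
        simp [this]
      · simp
    have h2 := LinearMap.congr_fun h1 ψ
    rwa [LinearMap.comp_apply, hψ.2 p] at h2
  have hphase : ∀ x : E → G, (∀ p, ∑ e, L.faceSign e p • x e = 0) → ∏ e, R.γ e (x e) = 1 := by
    intro x hx
    -- Only the two faces beside `e` contribute; exchanging the products then collects one character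
    -- per face.
    have h1 : ∀ e, R.γ e (x e) = ∏ p, c p (L.faceSign e p • x e) := by
      intro e
      simp only [faceSign_smul, AddChar.map_sub_eq_div, Finset.prod_div_distrib, apply_ite (c _),
        AddChar.map_zero_eq_one, Finset.prod_ite_eq, Finset.mem_univ, if_true, hc,
        AddChar.sub_apply']
    simp_rw [h1]
    rw [Finset.prod_comm]
    refine Finset.prod_eq_one fun p _ => ?_
    rw [← toMul_ofMul (∏ e, c p (L.faceSign e p • x e)), ofMul_prod]
    have h2 := map_sum (c p).toAddMonoidHom (fun e => L.faceSign e p • x e) Finset.univ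
    rw [hx p, map_zero] at h2
    exact congrArg Additive.toMul h2.symm
  conv_lhs => rw [← (ketBasis E G).sum_repr ψ]
  conv_rhs => rw [← (ketBasis E G).sum_repr ψ]
  rw [map_sum]
  refine Finset.sum_congr rfl fun x _ => ?_
  by_cases hx : (ketBasis E G).repr ψ x = 0
  · simp [hx]
  · rw [map_smul, PauliError.op_ketBasis]
    simp only [PauliError.zPart]
    rw [hphase x (hflat x hx), Circle.coe_one, one_smul]
    congr 2
    exact zero_add x

/-- On the ground space, a translation by a coboundary is trivial. -/
theorem shift_eq_self {L : OrientedLattice V E P} (c : V → G) {y : E → G}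
    (hc : ∀ e, y e = c (L.origin (e, true)) - c (L.origin (e, false))) {ψ : TotalSpace E G}
    (hψ : ψ ∈ L.groundSpace G) : shift y ψ = ψ := by
  classical
  have : Finite V := Finite.of_surjective _ L.origin_surjective
  cases nonempty_fintype V
  -- Each summand is the translation of the vertex operator `A_{c(v)}(v)`.
  have hy : y = ∑ v, fun e => L.vertexSign e v • c v := by
    funext e
    simp [Finset.sum_apply, vertexSign_smul, hc]
  rw [hy]
  refine Finset.sum_induction _ (fun z => shift z ψ = ψ) (fun a b ha hb => ?_) ?_ fun v _ => ?_
  · rw [shift_add, LinearMap.comp_apply, hb, ha]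
  · rw [shift_zero, LinearMap.id_apply]
  · exact vertexOp_eq_self hψ (c v) v

end OrientedLattice

end Kitaev

end

theorem mainTheorem6 {V E P G : Type*} [Fintype E] [AddCommGroup G] [Fintype G]
    (L : Kitaev.OrientedLattice V E P) (R : Kitaev.PauliError E G) :
    ((∀ v : V, L.HasVertexSyndrome R v 1) → L.IsContractible R.zPart.graph →
      ∀ ψ ∈ L.groundSpace G, R.zPart.op ψ = ψ) ∧
    ((∀ p : P, L.HasFaceSyndrome R p 0) → L.dual.IsContractible R.xPart.graph →
      ∀ ψ ∈ L.groundSpace G, R.xPart.op ψ = ψ) := by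
  constructor
  · intro hsyn hcon ψ hψ
    obtain ⟨c, hc⟩ := Kitaev.OrientedLattice.IsContractible.exists_boundary_eq R.γ
      (fun v => (hsyn v).sum_eq_zero)
      (fun C hC => hcon C fun e he => R.mem_graph_zPart e (hC he))
    exact Kitaev.OrientedLattice.zPart_op_eq_self c hc hψ
  · intro hsyn hcon ψ hψ
    obtain ⟨c, hc⟩ := Kitaev.OrientedLattice.IsContractible.exists_boundary_eq (L := L.dual) R.g
      (fun p => by
        simp only [L.dual_vertexSign, neg_smul, Finset.sum_neg_distrib, (hsyn p).sum_eq_zero,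
          neg_zero])
      (fun C hC => hcon C fun e he => R.mem_graph_xPart e (hC he))
    rw [R.xPart_op]
    exact Kitaev.OrientedLattice.shift_eq_self c hc hψ
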